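/- Write $[n]=\{1,\dots,n\}$, and let $d_{\mathrm H}$ be the normalized Hamming distance of strings of equal length. The distance between two distributions over $\Sigma^n$ ($\Sigma$ a finite alphabet) is the earth mover's distance with respect to $d_{\mathrm H}$. The distance of an input $x$ (a string or a distribution) from a property $S$ (a set of such inputs) is $\inf_{y\in S}d(x,y)$, and $x$ is $\varepsilon$-far from $S$ if this distance is larger than $\varepsilon$. An algorithm is an $\varepsilon$-test for $S$ if it accepts every $x\in S$ with probability larger than $2/3$ and every $x$ that is $\varepsilon$-far from $S$ with probability less than $1/3$; it is a one-sided $\varepsilon$-test if these probabilities are $1$ and less than $1/2$, respectively. A deterministic locally-bounded algorithm with $s$ samples for distributions over $\Sigma^n$ is a tuple $(T_1,\dots,T_s;A)$, where $T_i$ is a full decision tree of height $q_i$ that queries letters of the $i$-th sample only, and $A$ is a set of accepted tuples of leaves (a leaf being identified with the sequence of answers leading to it); it makes $q_1+\dots+q_s$ queries. A locally-bounded algorithm (for a fixed $s$) is a probability distribution over deterministic ones; on an input distribution $P$ it draws a deterministic algorithm and, independently, $s$ independent samples of $P$. A deterministic $2$-split adaptive algorithm for strings of length $2n$ is a tuple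 $(T_1,T_2;A)$, where $T_1$ and $T_2$ are full decision trees that query only the first half and only the second half of the string, respectively, and $A$ is a set of accepted pairs of leaves; it makes as many queries as the sum of the heights of the trees. A $2$-split adaptive algorithm is a probability distribution over deterministic ones. The number of queries of a randomized algorithm is the supremum of the numbers of queries of the deterministic algorithms in its support. Let $\mathbf{inv}$ be the set of strings of length $2n$ over $[n]$ that are concatenations of (the value tables of) two functions $f,g:[n]\to[n]$ such that $f=g$ or $g\circ f=\mathrm{id}$, and let $\mathbf{Inv}$ be the set of distributions over $[n]^{[n]}$ whose support is contained in $\{f,g\}$ for such a pair $(f,g)$. **Theorem.** 1. For every $n\ge 2$, every locally-bounded $\frac15$-test for $\mathbf{Inv}$ must make at least $\frac13\sqrt n$ queries. 2. For every $n\ge 2$, every $2$-split adaptive $\frac15$-test for $\mathbf{inv}$ must make at least $\frac13\sqrt n$ queries. 3. Let $\Sigma$ be a finite alphabet and let $n,s\ge 0$. There is a construction that turns every locally-bounded algorithm $\mathcal A$ with $s$ samples for distributions over $\Sigma^n$ into a $2$-split adaptive algorithm $\tilde{\mathcal A}$ for strings in $\Sigma^{2n}$ with the same number of queries, such that the following holds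 for every reflexive and symmetric relation $R\subseteq(\Sigma^n)^2$ and every $\varepsilon>0$. Let $\Pi_R$ be the set of strings $uv$ with $(u,v)\in R$, and let $\mathcal P_R$ be the set of distributions whose support is contained in a set $\{u,v\}$ with $(u,v)\in R$. If $\mathcal A$ is an $\varepsilon$-test for $\mathcal P_R$, then $\tilde{\mathcal A}$ is an $\varepsilon$-test for $\Pi_R$; and if $\mathcal A$ is a one-sided $\varepsilon$-test for $\mathcal P_R$, then $\tilde{\mathcal A}$ is a one-sided $\varepsilon$-test for $\Pi_R$. -/

import Mathlib

open scoped ENNReal NNReal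

namespace HugeObject

noncomputable section

/-! ### Distances -/

/-- Normalized Hamming distance of two strings indexed by `ι` (an index set of size `n`). -/
def normHamming {ι α : Type*} [Fintype ι] [DecidableEq α] (x y : ι → α) : ℝ≥0∞ :=
  (hammingDist x y : ℝ≥0∞) / (Fintype.card ι : ℝ≥0∞)

/-- `T` is a transfer distribution (coupling) between `P` and `Q`. -/
def IsTransfer {Ω : Type*} (T : PMF (Ω × Ω)) (P Q : PMF Ω) : Prop :=
  T.map Prod.fst = P ∧ T.map Prod.snd = Q

/-- Earth mover's distance with respect to a distance function `d` on a finite set. -/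
def emd {Ω : Type*} [Fintype Ω] (d : Ω → Ω → ℝ≥0∞) (P Q : PMF Ω) : ℝ≥0∞ :=
  ⨅ (T : PMF (Ω × Ω)) (_ : IsTransfer T P Q), ∑ z : Ω × Ω, T z * d z.1 z.2

/-- Distance of a point from a set, with respect to `d`. -/
def distToSet {X : Type*} (d : X → X → ℝ≥0∞) (x : X) (S : Set X) : ℝ≥0∞ :=
  ⨅ y ∈ S, d x y

/-! ### Decision trees -/

/-- Full decision trees of height `h` over strings `ι → α`: every internal node queries an
index and has one child for every possible answer; all leaves have depth `h`. -/
inductive DecisionTree (ι : Type) (α : Type*) : ℕ → Type _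
  | leaf : DecisionTree ι α 0
  | node {h : ℕ} (query : ι) (child : α → DecisionTree ι α h) : DecisionTree ι α (h + 1)

/-- The sequence of answers read along the path followed on input `x`; it identifies the
leaf that is reached. -/
def DecisionTree.answers {ι : Type} {α : Type*} :
    {h : ℕ} → DecisionTree ι α h → (ι → α) → (Fin h → α)
  | _, .leaf, _ => Fin.elim0
  | _, .node query child, x => Fin.cons (x query) ((child (x query)).answers x)

/-! ### Locally-bounded algorithms for distributions -/

/-- A deterministic `s`-sample locally-bounded algorithm `(T₁, …, Tₛ; A)` for strings of
length `n` over `α`: the tree `Tᵢ` queries the `i`-th sample only. Since the heights are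
fixed, the concatenation of the leaves of the trees is given by the tuple of the leaves. -/
structure LocallyBoundedAlg (α : Type*) (n s : ℕ) where
  height : Fin s → ℕ
  tree : (i : Fin s) → DecisionTree (Fin n) α (height i)
  accepted : Set ((i : Fin s) → Fin (height i) → α)

namespace LocallyBoundedAlg

variable {α : Type*} {n s : ℕ}

/-- Total number of queries. -/
def queries (D : LocallyBoundedAlg α n s) : ℕ := ∑ i, D.height i

/-- `D` accepts when the samples are `x 0, …, x (s - 1)`. -/
def Accepts (D : LocallyBoundedAlg α n s) (x : Fin s → Fin n → α) : Prop :=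
  (fun i => (D.tree i).answers (x i)) ∈ D.accepted

/-- Probability that `D` accepts when its `s` samples are drawn independently from `P`. -/
def acceptProb [Fintype α] (D : LocallyBoundedAlg α n s) (P : PMF (Fin n → α)) : ℝ≥0∞ :=
  ∑ x : Fin s → Fin n → α, {x | D.Accepts x}.indicator (fun x => ∏ i, P (x i)) x

end LocallyBoundedAlg

/-- Acceptance probability of a probabilistic locally-bounded algorithm, i.e. a
distribution over deterministic ones, on the input distribution `P`. -/
def lbAcceptProb {α : Type*} [Fintype α] {n s : ℕ} (A : PMF (LocallyBoundedAlg α n s))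
    (P : PMF (Fin n → α)) : ℝ≥0∞ :=
  ∑' D, A D * D.acceptProb P

/-- Worst-case number of queries of a probabilistic locally-bounded algorithm. -/
def lbQueries {α : Type*} {n s : ℕ} (A : PMF (LocallyBoundedAlg α n s)) : ℕ∞ :=
  ⨆ D ∈ A.support, (D.queries : ℕ∞)

/-! ### Split adaptive algorithms for strings -/

/-- The `i`-th block (of length `m`) of a string of length `k * m`: its `j`-th letter is the
letter of `w` at position `m * i + j` (counting from `0`). -/
def block {α : Type*} {k m : ℕ} (w : Fin (k * m) → α) (i : Fin k) : Fin m → α :=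
  fun j => w (finProdFinEquiv (i, j))

/-- A deterministic `k`-split adaptive algorithm for strings of length `k * m`: the `i`-th
tree queries the `i`-th block only. -/
structure SplitAlg (α : Type*) (k m : ℕ) where
  height : Fin k → ℕ
  tree : (i : Fin k) → DecisionTree (Fin m) α (height i)
  accepted : Set ((i : Fin k) → Fin (height i) → α)

namespace SplitAlg

variable {α : Type*} {k m : ℕ}

/-- Query complexity: the sum of the heights of the trees. -/
def queries (D : SplitAlg α k m) : ℕ := ∑ i, D.height i

/-- `D` accepts the string `w`. -/
def Accepts (D : SplitAlg α k m) (w : Fin (k * m) → α) : Prop :=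
  (fun i => (D.tree i).answers (block w i)) ∈ D.accepted

end SplitAlg

/-- Acceptance probability of a probabilistic split adaptive algorithm on the string `w`. -/
def splitAcceptProb {α : Type*} {k m : ℕ} (A : PMF (SplitAlg α k m))
    (w : Fin (k * m) → α) : ℝ≥0∞ :=
  ∑' D, {D : SplitAlg α k m | D.Accepts w}.indicator A D

/-- Worst-case number of queries of a probabilistic split adaptive algorithm. -/
def splitQueries {α : Type*} {k m : ℕ} (A : PMF (SplitAlg α k m)) : ℕ∞ :=
  ⨆ D ∈ A.support, (D.queries : ℕ∞)

/-! ### Testing -/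

/-- An algorithm that accepts the input `x` with probability `acc x` is an `ε`-test for
the property `S`, where `d` is the distance between inputs. -/
def IsTest {X : Type*} (acc : X → ℝ≥0∞) (d : X → X → ℝ≥0∞) (ε : ℝ≥0) (S : Set X) : Prop :=
  (∀ x ∈ S, 2 / 3 < acc x) ∧ (∀ x, (ε : ℝ≥0∞) < distToSet d x S → acc x < 1 / 3)

/-- The same with one-sided error. -/
def IsOneSidedTest {X : Type*} (acc : X → ℝ≥0∞) (d : X → X → ℝ≥0∞) (ε : ℝ≥0)
    (S : Set X) : Prop :=
  (∀ x ∈ S, acc x = 1) ∧ (∀ x, (ε : ℝ≥0∞) < distToSet d x S → acc x < 1 / 2)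

section

variable {α : Type*} [Fintype α] [DecidableEq α] {n s k m : ℕ}

/-- `A` is a locally-bounded `ε`-test for the property `S` of distributions over `αⁿ`. -/
def IsLBTest (A : PMF (LocallyBoundedAlg α n s)) (ε : ℝ≥0) (S : Set (PMF (Fin n → α))) :
    Prop :=
  IsTest (lbAcceptProb A) (emd normHamming) ε S

/-- `A` is a one-sided locally-bounded `ε`-test for the property `S`. -/
def IsOneSidedLBTest (A : PMF (LocallyBoundedAlg α n s)) (ε : ℝ≥0)
    (S : Set (PMF (Fin n → α))) : Prop :=
  IsOneSidedTest (lbAcceptProb A) (emd normHamming) ε S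

/-- `A` is a `k`-split adaptive `ε`-test for the property `S` of strings. -/
def IsSplitTest (A : PMF (SplitAlg α k m)) (ε : ℝ≥0) (S : Set (Fin (k * m) → α)) : Prop :=
  IsTest (splitAcceptProb A) normHamming ε S

/-- `A` is a one-sided `k`-split adaptive `ε`-test for the property `S` of strings. -/
def IsOneSidedSplitTest (A : PMF (SplitAlg α k m)) (ε : ℝ≥0)
    (S : Set (Fin (k * m) → α)) : Prop :=
  IsOneSidedTest (splitAcceptProb A) normHamming ε S

end

/-! ### Properties -/

/-- The property of strings of length `2n` that are concatenations `uv` with `R u v`. -/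
def pairStrings {α : Type*} {n : ℕ} (R : (Fin n → α) → (Fin n → α) → Prop) :
    Set (Fin (2 * n) → α) :=
  {w | R (block w 0) (block w 1)}

/-- The property of distributions over `αⁿ` supported by a set `{u, v}` with `R u v`. -/
def pairDistributions {α : Type*} {n : ℕ} (R : (Fin n → α) → (Fin n → α) → Prop) :
    Set (PMF (Fin n → α)) :=
  {P | ∃ u v, R u v ∧ P.support ⊆ {u, v}}

/-- The relation `f = g` or `g ∘ f = id` between functions `f, g : [n] → [n]`. -/
def EqOrInverse (n : ℕ) (f g : Fin n → Fin n) : Prop :=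
  (∀ i, f i = g i) ∨ (∀ i, g (f i) = i)

/-- The property `inv` of strings of length `2n` over `[n]`. -/
def invStrings (n : ℕ) : Set (Fin (2 * n) → Fin n) := pairStrings (EqOrInverse n)

/-- The property `Inv` of distributions over functions `[n] → [n]`. -/
def Inv (n : ℕ) : Set (PMF (Fin n → Fin n)) := pairDistributions (EqOrInverse n)

end

end HugeObject

namespace HugeObject

noncomputable section

/-! For the construction, every sample of the locally-bounded algorithm is assigned to one of the
two halves of `w` by a fair coin, and each half runs all the trees assigned to it. The result
accepts `w` exactly as often as the original algorithm accepts the uniform distribution `blockPMF w`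
on the two halves (`splitAcceptProb_randomSplit`). Membership passes from `w` to `blockPMF w`, and
so does farness (`distToSet_le_emd`). Hence the bound for `Inv` follows from the one for `inv`.

For strings, compare a random pair `(π, π⁻¹)`, which is in `inv`, with an independent random pair
`(π, σ)`. Unless the trees collide (one of them queries an argument that the other has seen as an
answer), any pair of leaves is at least as likely for the inverse pair as for the independent pair
(`card_independent_le`). A collision has probability at most `2 q₁ q₂ / n` (`card_collide_mul_le`),
which is at most `1/18` when `9 (q₁ + q₂)² < n`. By Markov's inequality the independent pair is far
from `inv` with probability at least `2/3` once `n ≥ 10` (`card_closePairs_mul_le`). A test would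
then accept inverse pairs with probability at least `12/18`, but at most `1/3 + (2/3)(1/3) + 1/18 =
11/18`. -/

/-! ### Concatenation of decision trees -/

/-- Run the first tree and then, independently of the outcome, the second one. -/
def DecisionTree.append {ι : Type} {α : Type*} {h₂ : ℕ} :
    {h₁ : ℕ} → DecisionTree ι α h₁ → DecisionTree ι α h₂ → DecisionTree ι α (h₂ + h₁)
  | _, .leaf, t => t
  | _, .node query child, t => .node query fun a => (child a).append t

theorem DecisionTree.answers_of_answers_append {ι : Type} {α : Type*} {h₁ h₂ : ℕ}
    (t₁ : DecisionTree ι α h₁) (t₂ : DecisionTree ι α h₂) {x y : ι → α}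
    (h : (t₁.append t₂).answers x = (t₁.append t₂).answers y) :
    t₁.answers x = t₁.answers y ∧ t₂.answers x = t₂.answers y := by
  induction t₁ with
  | leaf => exact ⟨rfl, h⟩
  | node query child ih =>
    simp only [append, answers] at h ⊢
    obtain ⟨h0, h1⟩ := Fin.cons_inj.1 h
    rw [← h0] at h1 ⊢
    obtain ⟨h2, h3⟩ := ih _ h1
    exact ⟨by rw [h2], h3⟩

/-- All that is needed of the concatenation is that its leaf determines the leaf of every part.
Stating only this avoids cutting a leaf into pieces along the sum of heights. -/
theorem DecisionTree.exists_concat {ι κ : Type} {α : Type*} (h : κ → ℕ)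
    (t : (i : κ) → DecisionTree ι α (h i)) (S : Finset κ) :
    ∃ T : DecisionTree ι α (∑ i ∈ S, h i), ∀ x y, T.answers x = T.answers y →
      ∀ i ∈ S, (t i).answers x = (t i).answers y := by
  classical
  induction S using Finset.induction_on with
  | empty => exact ⟨by rw [Finset.sum_empty]; exact .leaf, by simp⟩
  | insert a S ha ih =>
    obtain ⟨T, hT⟩ := ih
    rw [Finset.sum_insert ha]
    refine ⟨T.append (t a), fun x y hxy i hi => ?_⟩
    obtain ⟨h1, h2⟩ := DecisionTree.answers_of_answers_append _ _ hxy
    rcases Finset.mem_insert.1 hi with rfl | hi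
    · exact h2
    · exact hT x y h1 i hi

/-- A tree that runs all the trees `t i`, `i ∈ S`. -/
def DecisionTree.concat {ι κ : Type} {α : Type*} (h : κ → ℕ)
    (t : (i : κ) → DecisionTree ι α (h i)) (S : Finset κ) :
    DecisionTree ι α (∑ i ∈ S, h i) :=
  (DecisionTree.exists_concat h t S).choose

theorem DecisionTree.answers_of_answers_concat {ι κ : Type} {α : Type*} {h : κ → ℕ}
    {t : (i : κ) → DecisionTree ι α (h i)} {S : Finset κ} {x y : ι → α}
    (hxy : (concat h t S).answers x = (concat h t S).answers y) {i : κ} (hi : i ∈ S) :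
    (t i).answers x = (t i).answers y :=
  (DecisionTree.exists_concat h t S).choose_spec x y hxy i hi

/-! ### From samples to blocks -/

/-- The split algorithm that runs the tree of the `i`-th sample on the block `c i`. -/
def LocallyBoundedAlg.toSplit {α : Type*} {n s k : ℕ} (D : LocallyBoundedAlg α n s)
    (c : Fin s → Fin k) : SplitAlg α k n where
  height b := ∑ i with c i = b, D.height i
  tree b := DecisionTree.concat D.height D.tree (Finset.univ.filter fun i => c i = b)
  -- A witness string decides whether a leaf tuple is accepted; the choice is immaterial because the
  -- leaves determine the answers of all trees of `D`.
  accepted := {l | ∃ w : Fin (k * n) → α, (∀ b, (DecisionTree.concat D.height D.tree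
    (Finset.univ.filter fun i => c i = b)).answers (block w b) = l b) ∧
      D.Accepts fun i => block w (c i)}

theorem LocallyBoundedAlg.queries_toSplit {α : Type*} {n s k : ℕ}
    (D : LocallyBoundedAlg α n s) (c : Fin s → Fin k) : (D.toSplit c).queries = D.queries :=
  Finset.sum_fiberwise Finset.univ c D.height

theorem LocallyBoundedAlg.accepts_toSplit {α : Type*} {n s k : ℕ}
    (D : LocallyBoundedAlg α n s) (c : Fin s → Fin k) (w : Fin (k * n) → α) :
    (D.toSplit c).Accepts w ↔ D.Accepts fun i => block w (c i) := by
  constructor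
  · rintro ⟨w', hw', h⟩
    have : (fun i => (D.tree i).answers (block w' (c i))) =
        fun i => (D.tree i).answers (block w (c i)) := by
      funext i
      exact DecisionTree.answers_of_answers_concat (hw' (c i)) (by simp)
    unfold Accepts at h ⊢
    rwa [← this]
  · exact fun h => ⟨w, fun b => rfl, h⟩

/-- Assign every sample to a uniformly random block, independently. -/
def randomSplit {α : Type*} {n s : ℕ} (k : ℕ) [NeZero k] (A : PMF (LocallyBoundedAlg α n s)) :
    PMF (SplitAlg α k n) :=
  A.bind fun D => (PMF.uniformOfFintype (Fin s → Fin k)).map D.toSplit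

theorem splitQueries_randomSplit {α : Type*} {n s k : ℕ} [NeZero k]
    (A : PMF (LocallyBoundedAlg α n s)) : splitQueries (randomSplit k A) = lbQueries A := by
  unfold splitQueries lbQueries randomSplit
  apply le_antisymm
  · refine iSup₂_le fun E hE => ?_
    obtain ⟨D, hD, hE⟩ := (PMF.mem_support_bind_iff _ _ _).1 hE
    obtain ⟨c, -, rfl⟩ := (PMF.mem_support_map_iff _ _ _).1 hE
    rw [D.queries_toSplit]
    exact le_iSup₂_of_le D hD le_rfl
  · refine iSup₂_le fun D hD => ?_
    rw [← D.queries_toSplit (fun _ => (0 : Fin k))]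
    refine le_iSup₂_of_le (D.toSplit fun _ => (0 : Fin k)) ?_ le_rfl
    refine (PMF.mem_support_bind_iff _ _ _).2 ⟨D, hD, ?_⟩
    exact (PMF.mem_support_map_iff _ _ _).2 ⟨_, by simp, rfl⟩

/-- The uniform distribution over the blocks of `w`. -/
def blockPMF {α : Type*} {k n : ℕ} [NeZero k] (w : Fin (k * n) → α) : PMF (Fin n → α) :=
  (PMF.uniformOfFintype (Fin k)).map (block w)

theorem sum_map_mul {X Y : Type*} [Fintype X] [Fintype Y] (p : PMF X) (f : X → Y)
    (m : Y → ℝ≥0∞) : ∑ y, p.map f y * m y = ∑ x, p x * m (f x) := by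
  classical
  simp only [PMF.map_apply, tsum_fintype, Finset.sum_mul, ite_mul, zero_mul]
  rw [Finset.sum_comm]
  simp

/-- Sampling `s` times from the uniform distribution on the blocks amounts to drawing a uniform map
`c` from samples to blocks. Expanding the product of probabilities into a sum over `c` also covers
the case of equal blocks. -/
theorem acceptProb_blockPMF {α : Type*} [Fintype α] {n s k : ℕ} [NeZero k]
    (D : LocallyBoundedAlg α n s) (w : Fin (k * n) → α) :
    D.acceptProb (blockPMF w) = (PMF.uniformOfFintype (Fin s → Fin k)).toOuterMeasure
      {c | D.Accepts fun i => block w (c i)} := by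
  classical
  have hP : ∀ x : Fin s → Fin n → α, ∏ i, blockPMF w (x i) =
      ∑ c : Fin s → Fin k, if x = (fun i => block w (c i)) then ((k : ℝ≥0∞) ^ s)⁻¹ else 0 := by
    intro x
    simp only [blockPMF, PMF.map_apply, tsum_fintype, PMF.uniformOfFintype_apply,
      Fintype.card_fin]
    rw [Finset.prod_univ_sum, Fintype.piFinset_univ]
    refine Finset.sum_congr rfl fun c _ => ?_
    split_ifs with h
    · simp [h, ENNReal.inv_pow]
    · obtain ⟨i, hi⟩ := Function.ne_iff.1 h
      exact Finset.prod_eq_zero (Finset.mem_univ i) (if_neg hi)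
  unfold LocallyBoundedAlg.acceptProb
  simp only [Set.indicator_apply, Set.mem_ofPred_eq, hP, PMF.toOuterMeasure_apply, tsum_fintype,
    PMF.uniformOfFintype_apply, Fintype.card_fun, Fintype.card_fin, Nat.cast_pow]
  have hx : ∀ x : Fin s → Fin n → α,
      (if D.Accepts x then ∑ c : Fin s → Fin k,
        if x = (fun i => block w (c i)) then ((k : ℝ≥0∞) ^ s)⁻¹ else 0 else 0) =
      ∑ c : Fin s → Fin k, if x = (fun i => block w (c i)) then
        if D.Accepts (fun i => block w (c i)) then ((k : ℝ≥0∞) ^ s)⁻¹ else 0 else 0 := by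
    intro x
    split_ifs with h
    · refine Finset.sum_congr rfl fun c _ => ?_
      split_ifs with h1 h2
      · rfl
      · exact absurd (h1 ▸ h) h2
      · rfl
    · refine (Finset.sum_eq_zero fun c _ => ?_).symm
      split_ifs with h1 h2
      · exact absurd (h1 ▸ h2) h
      · rfl
      · rfl
  simp only [hx]
  rw [Finset.sum_comm]
  simp

theorem splitAcceptProb_randomSplit {α : Type*} [Fintype α] {n s k : ℕ} [NeZero k]
    (A : PMF (LocallyBoundedAlg α n s)) (w : Fin (k * n) → α) :
    splitAcceptProb (randomSplit k A) w = lbAcceptProb A (blockPMF w) := by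
  have h : splitAcceptProb (randomSplit k A) w =
      (randomSplit k A).toOuterMeasure {D | D.Accepts w} := (PMF.toOuterMeasure_apply _ _).symm
  rw [h, randomSplit, PMF.toOuterMeasure_bind_apply]
  refine tsum_congr fun D => ?_
  rw [PMF.toOuterMeasure_map_apply, acceptProb_blockPMF]
  simp only [Set.preimage_ofPred_eq, D.accepts_toSplit]

/-! ### Distances -/

/-- The string with blocks `u b`. -/
def ofBlocks {α : Type*} {k n : ℕ} (u : Fin k → Fin n → α) : Fin (k * n) → α :=
  fun j => u (finProdFinEquiv.symm j).1 (finProdFinEquiv.symm j).2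

@[simp]
theorem block_ofBlocks {α : Type*} {k n : ℕ} (u : Fin k → Fin n → α) (b : Fin k) :
    block (ofBlocks u) b = u b := by
  funext j
  simp only [block, ofBlocks, Equiv.symm_apply_apply]

theorem hammingDist_eq_sum_block {α : Type*} [DecidableEq α] {k n : ℕ}
    (w w' : Fin (k * n) → α) :
    hammingDist w w' = ∑ b, hammingDist (block w b) (block w' b) := by
  simp only [hammingDist, Finset.card_filter]
  rw [← Fintype.sum_prod_type', ← Equiv.sum_comp finProdFinEquiv]
  rfl

theorem normHamming_eq_sum_block {α : Type*} [DecidableEq α] {k n : ℕ} [NeZero k]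
    (w w' : Fin (k * n) → α) :
    normHamming w w' = ∑ b, (k : ℝ≥0∞)⁻¹ * normHamming (block w b) (block w' b) := by
  simp only [normHamming, hammingDist_eq_sum_block w w', Fintype.card_fin, ← Finset.mul_sum,
    div_eq_mul_inv, ← Finset.sum_mul, Nat.cast_sum, Nat.cast_mul]
  rw [ENNReal.mul_inv (by simp) (by simp)]
  ring

/-- Replace each half of `w` by the nearer of `u` and `v`. This costs the average of the two minima,
and no transfer to a distribution supported by `{u, v}` can be cheaper. -/
theorem distToSet_le_emd {α : Type*} [Fintype α] [DecidableEq α] {n : ℕ}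
    {R : (Fin n → α) → (Fin n → α) → Prop} (hr : ∀ u, R u u) (hs : ∀ u v, R u v → R v u)
    (w : Fin (2 * n) → α) {Q : PMF (Fin n → α)} (hQ : Q ∈ pairDistributions R) :
    distToSet normHamming w (pairStrings R) ≤ emd normHamming (blockPMF w) Q := by
  obtain ⟨u, v, huv, hsupp⟩ := hQ
  refine le_iInf₂ fun T hT => ?_
  set m : (Fin n → α) → ℝ≥0∞ := fun a => min (normHamming a u) (normHamming a v) with hm
  have hmin : ∀ a, ∃ y, (y = u ∨ y = v) ∧ normHamming a y = m a := by
    intro a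
    rcases min_choice (normHamming a u) (normHamming a v) with h | h
    · exact ⟨u, .inl rfl, h.symm⟩
    · exact ⟨v, .inr rfl, h.symm⟩
  choose y hy hym using hmin
  -- Both halves may choose the same string, or choose in the order `v`, `u`; this is where
  -- reflexivity and symmetry enter.
  have hR : R (y (block w 0)) (y (block w 1)) := by
    rcases hy (block w 0) with h | h <;> rcases hy (block w 1) with h' | h' <;>
      rw [h, h']
    exacts [hr _, huv, hs _ _ huv, hr _]
  calc distToSet normHamming w (pairStrings R)
      ≤ normHamming w (ofBlocks fun b => y (block w b)) :=
        iInf₂_le _ (by simpa [pairStrings] using hR)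
    _ = ∑ b, PMF.uniformOfFintype (Fin 2) b * m (block w b) := by
        rw [normHamming_eq_sum_block]
        simp [hym]
    _ = ∑ a, blockPMF w a * m a := (sum_map_mul _ _ _).symm
    _ = ∑ z, T z * m z.1 := by rw [← hT.1, sum_map_mul]
    _ ≤ ∑ z, T z * normHamming z.1 z.2 := by
        refine Finset.sum_le_sum fun z _ => ?_
        by_cases hz : T z = 0
        · simp [hz]
        · have hz2 : z.2 ∈ Q.support := by
            rw [← hT.2]
            exact (PMF.mem_support_map_iff _ _ _).2 ⟨z, hz, rfl⟩
          gcongr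
          rcases hsupp hz2 with h | h <;> rw [h]
          exacts [min_le_left _ _, min_le_right _ _]

theorem far_blockPMF {α : Type*} [Fintype α] [DecidableEq α] {n : ℕ}
    {R : (Fin n → α) → (Fin n → α) → Prop} (hr : ∀ u, R u u) (hs : ∀ u v, R u v → R v u)
    {w : Fin (2 * n) → α} {ε : ℝ≥0∞} (h : ε < distToSet normHamming w (pairStrings R)) :
    ε < distToSet (emd normHamming) (blockPMF w) (pairDistributions R) :=
  h.trans_le (le_iInf₂ fun _ hQ => distToSet_le_emd hr hs w hQ)

theorem blockPMF_mem_pairDistributions {α : Type*} {n : ℕ}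
    {R : (Fin n → α) → (Fin n → α) → Prop} {w : Fin (2 * n) → α} (h : w ∈ pairStrings R) :
    blockPMF w ∈ pairDistributions R := by
  refine ⟨_, _, h, fun x hx => ?_⟩
  obtain ⟨b, -, rfl⟩ := (PMF.mem_support_map_iff _ _ _).1 hx
  fin_cases b <;> simp

theorem isSplitTest_randomSplit {α : Type*} [Fintype α] [DecidableEq α] {n s : ℕ}
    {R : (Fin n → α) → (Fin n → α) → Prop} (hr : ∀ u, R u u) (hs : ∀ u v, R u v → R v u)
    {A : PMF (LocallyBoundedAlg α n s)} {ε : ℝ≥0} (h : IsLBTest A ε (pairDistributions R)) :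
    IsSplitTest (randomSplit 2 A) ε (pairStrings R) :=
  ⟨fun w hw => (h.1 _ (blockPMF_mem_pairDistributions hw)).trans_eq
      (splitAcceptProb_randomSplit A w).symm,
    fun w hw => (splitAcceptProb_randomSplit A w).trans_lt (h.2 _ (far_blockPMF hr hs hw))⟩

theorem isOneSidedSplitTest_randomSplit {α : Type*} [Fintype α] [DecidableEq α] {n s : ℕ}
    {R : (Fin n → α) → (Fin n → α) → Prop} (hr : ∀ u, R u u) (hs : ∀ u v, R u v → R v u)
    {A : PMF (LocallyBoundedAlg α n s)} {ε : ℝ≥0}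
    (h : IsOneSidedLBTest A ε (pairDistributions R)) :
    IsOneSidedSplitTest (randomSplit 2 A) ε (pairStrings R) :=
  ⟨fun w hw => (splitAcceptProb_randomSplit A w).trans
      (h.1 _ (blockPMF_mem_pairDistributions hw)),
    fun w hw => (splitAcceptProb_randomSplit A w).trans_lt (h.2 _ (far_blockPMF hr hs hw))⟩

/-! ### Queried indices -/

/-- The set of indices queried by a decision tree on the input `x`. -/
def DecisionTree.queried {ι : Type} {α : Type*} [DecidableEq ι] :
    {h : ℕ} → DecisionTree ι α h → (ι → α) → Finset ι
  | _, .leaf, _ => ∅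
  | _, .node query child, x => insert query ((child (x query)).queried x)

theorem DecisionTree.card_queried_le {ι : Type} {α : Type*} [DecidableEq ι] {h : ℕ}
    (t : DecisionTree ι α h) (x : ι → α) : (t.queried x).card ≤ h := by
  induction t with
  | leaf => simp [queried]
  | node query child ih =>
    exact (Finset.card_insert_le _ _).trans (Nat.succ_le_succ (ih _))

/-- Reaching a given leaf thus means having prescribed values on a fixed set, an event that can be
counted for permutations. -/
theorem DecisionTree.answers_eq_iff {ι : Type} {α : Type*} [DecidableEq ι] {h : ℕ}
    (t : DecisionTree ι α h) (x y : ι → α) :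
    t.answers y = t.answers x ↔ ∀ i ∈ t.queried x, y i = x i := by
  induction t with
  | leaf => simp [queried, answers]
  | node query child ih =>
    simp only [answers, queried, Fin.cons_inj, Finset.forall_mem_insert]
    refine and_congr_right fun h => ?_
    rw [h]
    exact ih _

/-! ### Counting permutations -/

section Permutations

open Equiv Nat

variable {α : Type} [Fintype α] [DecidableEq α]

theorem card_perm_eqOn (τ : Perm α) (X : Finset α) :
    (Finset.univ.filter fun σ : Perm α => ∀ x ∈ X, σ x = τ x).card =
      (Fintype.card α - X.card)! := by
  have e1 : (Finset.univ.filter fun σ : Perm α => ∀ x ∈ X, σ x = τ x).card =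
      (Finset.univ.filter fun σ : Perm α => ∀ x, ¬ x ∉ X → σ x = x).card := by
    refine Finset.card_bij' (fun σ _ => τ⁻¹ * σ) (fun σ _ => τ * σ) ?_ ?_ ?_ ?_
    · intro σ hσ
      simp only [Finset.mem_filter, Finset.mem_univ, true_and, not_not] at hσ ⊢
      intro x hx
      simp [hσ x hx]
    · intro σ hσ
      simp only [Finset.mem_filter, Finset.mem_univ, true_and, not_not] at hσ ⊢
      intro x hx
      simp [hσ x hx]
    · simp
    · simp
  rw [e1, ← Fintype.card_subtype,
    ← Fintype.card_congr (Perm.subtypeEquivSubtypePerm fun x => x ∉ X), Fintype.card_perm]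
  congr 1
  rw [Fintype.card_subtype_compl, Fintype.card_coe]

theorem factorial_sub_mul_factorial_sub_le {n k l : ℕ} (h : k + l ≤ n) :
    (n - k)! * (n - l)! ≤ n ! * (n - (k + l))! := by
  have h1 := Nat.factorial_mul_descFactorial (n := n) (k := k) (by omega)
  have h2 := Nat.factorial_mul_descFactorial (n := n - l) (k := k) (by omega)
  have h3 : n - l - k = n - (k + l) := by omega
  rw [h3] at h2
  have h4 : (n - l).descFactorial k ≤ n.descFactorial k :=
    Nat.descFactorial_le k (by omega)
  rw [← h1, ← h2]
  calc (n - k)! * ((n - (k + l))! * (n - l).descFactorial k)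
      ≤ (n - k)! * ((n - (k + l))! * n.descFactorial k) := by gcongr
    _ = _ := by ring

/-- Take `π` on `X` and `σ⁻¹` on the image of `Z`. The two hypotheses make this partial map
injective, so it extends to a permutation. -/
theorem exists_perm_extending (π σ : Perm α) (X Z : Finset α) (h1 : ∀ x ∈ X, π x ∉ Z)
    (h2 : ∀ z ∈ Z, σ z ∉ X) :
    ∃ τ : Perm α, (∀ x ∈ X, τ x = π x) ∧ ∀ z ∈ Z, τ (σ z) = z := by
  let f : α → α := fun x => if x ∈ X then π x else σ⁻¹ x
  have hinj : Set.InjOn f (X ∪ Z.image σ : Finset α) := by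
    intro x hx y hy hxy
    simp only [Finset.coe_union, Finset.coe_image, Set.mem_union, Finset.mem_coe,
      Set.mem_image] at hx hy
    simp only [f] at hxy
    split_ifs at hxy with hxX hyX hyX
    · exact π.injective hxy
    · obtain ⟨z, hz, rfl⟩ := hy.resolve_left hyX
      rw [Perm.coe_inv, Equiv.symm_apply_apply] at hxy
      exact absurd (hxy ▸ hz) (h1 x hxX)
    · obtain ⟨z, hz, rfl⟩ := hx.resolve_left hxX
      rw [Perm.coe_inv, Equiv.symm_apply_apply] at hxy
      exact absurd (hxy ▸ hz) (h1 y hyX)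
    · exact (σ⁻¹).injective hxy
  obtain ⟨g, hg⟩ := Finset.exists_equiv_extend_of_card_eq (t := Finset.univ)
    (Finset.card_univ).symm (Finset.subset_univ _) hinj
  refine ⟨g.trans (Equiv.subtypeUnivEquiv Finset.mem_univ), fun x hx => ?_, fun z hz => ?_⟩
  · simpa [f, hx] using hg x (by simp [hx])
  · simpa [f, h2 z hz] using hg (σ z) (by simp [hz])

/-- Without collisions, `X` and `σ(Z)` are disjoint, so the joint event prescribes `|X| + |Z|`
values of one permutation. Without replacement this is at least as likely as two independent
prescriptions of `|X|` and `|Z|` values. -/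
theorem card_extending_mul_le (π σ : Perm α) (X Z : Finset α) (h1 : ∀ x ∈ X, π x ∉ Z)
    (h2 : ∀ z ∈ Z, σ z ∉ X) :
    (Finset.univ.filter fun π' : Perm α => ∀ x ∈ X, π' x = π x).card *
      (Finset.univ.filter fun σ' : Perm α => ∀ z ∈ Z, σ' z = σ z).card ≤
    (Fintype.card α)! * (Finset.univ.filter fun τ : Perm α =>
      (∀ x ∈ X, τ x = π x) ∧ ∀ z ∈ Z, τ⁻¹ z = σ z).card := by
  obtain ⟨τ, hτ1, hτ2⟩ := exists_perm_extending π σ X Z h1 h2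
  have hdisj : Disjoint X (Z.image σ) := by
    rw [Finset.disjoint_left]
    intro x hx hx'
    obtain ⟨z, hz, rfl⟩ := Finset.mem_image.1 hx'
    exact h2 z hz hx
  have hcard : (X ∪ Z.image σ).card = X.card + Z.card := by
    rw [Finset.card_union_of_disjoint hdisj, Finset.card_image_of_injective _ σ.injective]
  have hle : X.card + Z.card ≤ Fintype.card α := hcard ▸ Finset.card_le_univ _
  rw [card_perm_eqOn, card_perm_eqOn]
  refine (factorial_sub_mul_factorial_sub_le hle).trans ?_
  gcongr
  rw [← hcard, ← card_perm_eqOn τ]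
  refine Finset.card_le_card fun ρ hρ => ?_
  simp only [Finset.mem_filter, Finset.mem_univ, true_and] at hρ ⊢
  refine ⟨fun x hx => (hρ x (by simp [hx])).trans (hτ1 x hx), fun z hz => ?_⟩
  rw [Perm.inv_eq_iff_eq, hρ _ (Finset.mem_union_right _ (Finset.mem_image_of_mem _ hz)),
    hτ2 z hz]

/-! ### Hitting a given value -/

/-- Given values on `X` that avoid `z`, the chance that `q` adaptive queries find `z` is at most `q
/ (N - |X|)`, where `N` is the size of `α`. A new query finds `z` with chance `1 / (N - |X|)`;
otherwise one more value is known and induction applies. -/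
theorem card_hit_mul_le_aux {q : ℕ} (t : DecisionTree α α q) (τ : Perm α) (X : Finset α)
    {z : α} (hz : ∀ x ∈ X, τ x ≠ z) :
    (Fintype.card α - X.card) * (Finset.univ.filter fun π : Perm α =>
        (∀ x ∈ X, π x = τ x) ∧ ∃ x ∈ t.queried π, π x = z).card ≤
      q * (Fintype.card α - X.card)! := by
  induction t generalizing τ X with
  | leaf => simp [DecisionTree.queried]
  | @node q query child ih =>
    by_cases hq : query ∈ X
    · have key := ih (τ query) τ X hz
      refine le_trans ?_ (key.trans (Nat.mul_le_mul_right _ (Nat.le_succ q)))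
      refine Nat.mul_le_mul_left _ (Finset.card_le_card fun π hπ => ?_)
      simp only [Finset.mem_filter, Finset.mem_univ, true_and, DecisionTree.queried,
        Finset.exists_mem_insert] at hπ ⊢
      obtain ⟨h1, h2⟩ := hπ
      rw [h1 query hq] at h2
      exact ⟨h1, h2.resolve_left (hz _ hq)⟩
    · obtain ⟨M, hM⟩ : ∃ M, Fintype.card α - X.card = M + 1 := by
        have : (insert query X).card ≤ Fintype.card α := Finset.card_le_univ _
        rw [Finset.card_insert_of_notMem hq] at this
        exact ⟨Fintype.card α - X.card - 1, by omega⟩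
      have hM' : Fintype.card α - (insert query X).card = M := by
        rw [Finset.card_insert_of_notMem hq]; omega
      set S := Finset.univ.filter fun π : Perm α => (∀ x ∈ X, π x = τ x) ∧
        ∃ x ∈ (DecisionTree.node query child).queried π, π x = z with hS
      -- the possible answers other than `z`
      set Y : Finset α := Finset.univ \ insert z (X.image τ) with hY
      have hYc : Y.card = M := by
        rw [hY, Finset.card_sdiff_of_subset (Finset.subset_univ _), Finset.card_univ,
          Finset.card_insert_of_notMem, Finset.card_image_of_injective _ τ.injective]
        · omega
        · intro h
          obtain ⟨x, hx, h⟩ := Finset.mem_image.1 h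
          exact hz x hx h
      have hmaps : ∀ π ∈ S, π query ∈ insert z Y := by
        intro π hπ
        have h1 := (Finset.mem_filter.1 hπ).2.1
        by_cases h : π query = z
        · simp [h]
        · simp only [hY, Finset.mem_insert, Finset.mem_sdiff, Finset.mem_univ, true_and,
            Finset.mem_image, h, false_or, not_exists, not_and]
          intro x hx hxq
          rw [← h1 x hx] at hxq
          exact hq (π.injective hxq ▸ hx)
      have hfib : ∀ y (U : Finset (Perm α)), (∀ π ∈ U, (∀ x ∈ X, π x = τ x) ∧ π query = y) →
          U.card ≤ M ! := by
        intro y U hU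
        rcases U.eq_empty_or_nonempty with rfl | ⟨τ', hτ'⟩
        · simp
        · rw [← hM', ← card_perm_eqOn τ']
          refine Finset.card_le_card fun π hπ => ?_
          simp only [Finset.mem_filter, Finset.mem_univ, true_and, Finset.forall_mem_insert]
          refine ⟨by rw [(hU π hπ).2, (hU τ' hτ').2], fun x hx => ?_⟩
          rw [(hU π hπ).1 x hx, (hU τ' hτ').1 x hx]
      have hz1 : (S.filter fun π => π query = z).card ≤ M ! :=
        hfib z _ fun π hπ => ⟨(Finset.mem_filter.1 (Finset.mem_filter.1 hπ).1).2.1,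
          (Finset.mem_filter.1 hπ).2⟩
      have hy1 : ∀ y ∈ Y, M * (S.filter fun π => π query = y).card ≤ q * M ! := by
        intro y hy
        have hyz : y ≠ z := by
          rintro rfl
          simp [hY] at hy
        rcases (S.filter fun π => π query = y).eq_empty_or_nonempty with h0 | ⟨τ', hτ'⟩
        · simp [h0]
        · simp only [hS, Finset.mem_filter, Finset.mem_univ, true_and] at hτ'
          obtain ⟨⟨ht1, -⟩, ht2⟩ := hτ'
          have key := ih y τ' (insert query X) (by
            simp only [Finset.forall_mem_insert]
            exact ⟨ht2 ▸ hyz, fun x hx => ht1 x hx ▸ hz x hx⟩)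
          rw [hM'] at key
          refine le_trans (Nat.mul_le_mul_left _ (Finset.card_le_card fun π hπ => ?_)) key
          simp only [hS, Finset.mem_filter, Finset.mem_univ, true_and, DecisionTree.queried,
            Finset.exists_mem_insert, Finset.forall_mem_insert] at hπ ⊢
          obtain ⟨⟨h1, h2⟩, h3⟩ := hπ
          rw [h3] at h2
          exact ⟨⟨by rw [h3, ht2], fun x hx => by rw [h1 x hx, ht1 x hx]⟩,
            h2.resolve_left hyz⟩
      have hsum : ∑ y ∈ Y, (S.filter fun π => π query = y).card ≤ q * M ! := by
        -- For `M = 0` the factor `M` cannot be cancelled, but then `z` is the only possible answer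
        -- and `Y` is empty.
        rcases Nat.eq_zero_or_pos M with h0 | h0
        · rw [h0, Finset.card_eq_zero] at hYc
          simp [hYc]
        · refine Nat.le_of_mul_le_mul_left ?_ h0
          rw [Finset.mul_sum]
          refine (Finset.sum_le_sum hy1).trans ?_
          simp [hYc]
      have hScard : S.card ≤ (q + 1) * M ! := by
        rw [Finset.card_eq_sum_card_fiberwise (f := fun π : Perm α => π query)
          (t := insert z Y) hmaps, Finset.sum_insert (by simp [hY])]
        linarith
      rw [hM, Nat.factorial_succ]
      calc (M + 1) * S.card ≤ (M + 1) * ((q + 1) * M !) := Nat.mul_le_mul_left _ hScard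
        _ = _ := by ring

theorem card_hit_mul_le {q : ℕ} (t : DecisionTree α α q) (z : α) :
    Fintype.card α * (Finset.univ.filter fun π : Perm α => ∃ x ∈ t.queried π, π x = z).card ≤
      q * (Fintype.card α)! := by
  simpa using card_hit_mul_le_aux t 1 ∅ (z := z) (by simp)

theorem card_hit_set_mul_le {q : ℕ} (t : DecisionTree α α q) (Z : Finset α) :
    Fintype.card α * (Finset.univ.filter fun π : Perm α => ∃ x ∈ t.queried π, π x ∈ Z).card ≤
      Z.card * (q * (Fintype.card α)!) := by
  have h : (Finset.univ.filter fun π : Perm α => ∃ x ∈ t.queried π, π x ∈ Z) ⊆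
      Z.biUnion fun z => Finset.univ.filter fun π : Perm α => ∃ x ∈ t.queried π, π x = z := by
    intro π hπ
    simpa [and_comm] using hπ
  calc _ ≤ Fintype.card α * ∑ z ∈ Z, (Finset.univ.filter fun π : Perm α =>
        ∃ x ∈ t.queried π, π x = z).card :=
        Nat.mul_le_mul_left _ ((Finset.card_le_card h).trans Finset.card_biUnion_le)
    _ ≤ ∑ z ∈ Z, q * (Fintype.card α)! := by
        rw [Finset.mul_sum]
        exact Finset.sum_le_sum fun z _ => card_hit_mul_le t z
    _ = _ := by simp

/-! ### Collisions -/

/-- The trees run on `π` and `σ` reveal that `σ` is not consistent with `π⁻¹`, or find a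
common pair of an argument and a value. -/
def Collide {q₁ q₂ : ℕ} (t₁ : DecisionTree α α q₁) (t₂ : DecisionTree α α q₂)
    (p : Perm α × Perm α) : Prop :=
  (∃ x ∈ t₁.queried p.1, p.1 x ∈ t₂.queried p.2) ∨
    ∃ z ∈ t₂.queried p.2, p.2 z ∈ t₁.queried p.1

open Classical in
-- For fixed `σ`, the second tree queries a fixed set of at most `q₂` arguments, and the first tree
-- hits each of them as a value of `π` with probability at most `q₁ / n`. The other kind of
-- collision is symmetric.
theorem card_collide_mul_le {q₁ q₂ : ℕ} (t₁ : DecisionTree α α q₁)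
    (t₂ : DecisionTree α α q₂) :
    Fintype.card α * (Finset.univ.filter fun p => Collide t₁ t₂ p).card ≤
      2 * (q₁ * q₂) * ((Fintype.card α)! * (Fintype.card α)!) := by
  have h1 : Fintype.card α * (Finset.univ.filter fun p : Perm α × Perm α =>
      ∃ x ∈ t₁.queried p.1, p.1 x ∈ t₂.queried p.2).card ≤
        q₁ * q₂ * ((Fintype.card α)! * (Fintype.card α)!) := by
    rw [Finset.card_filter, Fintype.sum_prod_type_right, Finset.mul_sum]
    calc _ ≤ ∑ _σ : Perm α, q₂ * (q₁ * (Fintype.card α)!) := by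
          refine Finset.sum_le_sum fun σ _ => ?_
          rw [← Finset.card_filter]
          exact (card_hit_set_mul_le t₁ (t₂.queried σ)).trans
            (Nat.mul_le_mul_right _ (t₂.card_queried_le _))
      _ = _ := by
          simp [Fintype.card_perm]
          ring
  have h2 : Fintype.card α * (Finset.univ.filter fun p : Perm α × Perm α =>
      ∃ z ∈ t₂.queried p.2, p.2 z ∈ t₁.queried p.1).card ≤
        q₁ * q₂ * ((Fintype.card α)! * (Fintype.card α)!) := by
    rw [Finset.card_filter, Fintype.sum_prod_type, Finset.mul_sum]
    calc _ ≤ ∑ _σ : Perm α, q₁ * (q₂ * (Fintype.card α)!) := by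
          refine Finset.sum_le_sum fun σ _ => ?_
          rw [← Finset.card_filter]
          exact (card_hit_set_mul_le t₂ (t₁.queried σ)).trans
            (Nat.mul_le_mul_right _ (t₁.card_queried_le _))
      _ = _ := by
          simp [Fintype.card_perm]
          ring
  have h3 : (Finset.univ.filter fun p : Perm α × Perm α => Collide t₁ t₂ p) ⊆
      (Finset.univ.filter fun p : Perm α × Perm α =>
        ∃ x ∈ t₁.queried p.1, p.1 x ∈ t₂.queried p.2) ∪
      (Finset.univ.filter fun p : Perm α × Perm α =>
        ∃ z ∈ t₂.queried p.2, p.2 z ∈ t₁.queried p.1) := by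
    intro p hp
    have h := (Finset.mem_filter.1 hp).2
    simpa [Collide] using h
  calc _ ≤ _ := Nat.mul_le_mul_left _ ((Finset.card_le_card h3).trans (Finset.card_union_le _ _))
    _ ≤ _ := by rw [mul_add, mul_assoc 2]; linarith

open Classical in
-- Group the non-colliding pairs by their leaves. Being collision-free depends on the leaves alone,
-- so `card_extending_mul_le` bounds each group by its counterpart for inverse pairs.
theorem card_independent_le {q₁ q₂ : ℕ} (t₁ : DecisionTree α α q₁)
    (t₂ : DecisionTree α α q₂) (B : Set ((Fin q₁ → α) × (Fin q₂ → α))) :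
    (Finset.univ.filter fun p : Perm α × Perm α =>
        (t₁.answers p.1, t₂.answers p.2) ∈ B).card ≤
      (Fintype.card α)! * (Finset.univ.filter fun π : Perm α =>
        (t₁.answers π, t₂.answers ⇑π⁻¹) ∈ B).card +
      (Finset.univ.filter fun p => Collide t₁ t₂ p).card := by
  set leaves : Perm α × Perm α → (Fin q₁ → α) × (Fin q₂ → α) :=
    fun p => (t₁.answers p.1, t₂.answers p.2) with hl
  set S := Finset.univ.filter fun p : Perm α × Perm α => leaves p ∈ B ∧ ¬ Collide t₁ t₂ p
    with hS
  have h1 : (Finset.univ.filter fun p : Perm α × Perm α => leaves p ∈ B).card ≤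
      S.card + (Finset.univ.filter fun p => Collide t₁ t₂ p).card := by
    refine (Finset.card_le_card fun p hp => ?_).trans (Finset.card_union_le _ _)
    simp only [hS, Finset.mem_union, Finset.mem_filter, Finset.mem_univ, true_and] at hp ⊢
    by_cases h : Collide t₁ t₂ p
    exacts [.inr h, .inl ⟨hp, h⟩]
  refine h1.trans (Nat.add_le_add_right ?_ _)
  set V := Finset.univ.filter fun π : Perm α => leaves (π, π⁻¹) ∈ B with hV
  have h2 : ∀ l ∈ S.image leaves, (S.filter fun p => leaves p = l).card ≤
      (Fintype.card α)! * (V.filter fun π => leaves (π, π⁻¹) = l).card := by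
    intro l hl'
    obtain ⟨⟨π, σ⟩, hp, rfl⟩ := Finset.mem_image.1 hl'
    obtain ⟨-, hB, hnc⟩ := Finset.mem_filter.1 hp
    simp only [Collide, not_or, not_exists, not_and] at hnc
    refine le_trans ?_ ((card_extending_mul_le π σ _ _ hnc.1 hnc.2).trans
      (Nat.mul_le_mul_left _ ?_))
    · rw [← Finset.card_product]
      refine Finset.card_le_card fun p hp => ?_
      simp only [hl, Finset.mem_filter, Prod.mk.injEq, DecisionTree.answers_eq_iff] at hp
      simpa using hp.2
    · refine Finset.card_le_card fun τ hτ => ?_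
      simp only [Finset.mem_filter, Finset.mem_univ, true_and] at hτ
      have : leaves (τ, τ⁻¹) = leaves (π, σ) := by
        simp only [hl, Prod.mk.injEq, DecisionTree.answers_eq_iff]
        exact hτ
      simp only [hV, Finset.mem_filter, Finset.mem_univ, true_and, this, and_true]
      exact hB
  calc S.card = ∑ l ∈ S.image leaves, (S.filter fun p => leaves p = l).card :=
        Finset.card_eq_sum_card_image _ _
    _ ≤ ∑ l ∈ S.image leaves, (Fintype.card α)! *
          (V.filter fun π => leaves (π, π⁻¹) = l).card := Finset.sum_le_sum h2
    _ ≤ (Fintype.card α)! * V.card := by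
        rw [← Finset.mul_sum]
        refine Nat.mul_le_mul_left _ ?_
        rw [← Finset.card_biUnion]
        · exact Finset.card_le_card (Finset.biUnion_subset.2 fun l _ => Finset.filter_subset _ _)
        · intro l _ l' _ hne
          exact Finset.disjoint_filter.2 fun π _ h h' => hne (h.symm.trans h')

/-! ### Agreements of random permutations -/

theorem sum_card_agree (τ : Perm α) [Nonempty α] :
    ∑ σ : Perm α, (Finset.univ.filter fun i => σ i = τ i).card = (Fintype.card α)! := by
  simp only [Finset.card_filter]
  rw [Finset.sum_comm]
  have h : ∀ i, (∑ σ : Perm α, if σ i = τ i then 1 else 0) = (Fintype.card α - 1)! := by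
    intro i
    rw [← Finset.card_filter]
    simpa using card_perm_eqOn τ {i}
  simp only [h, Finset.sum_const, Finset.card_univ, smul_eq_mul]
  exact Nat.mul_factorial_pred Fintype.card_ne_zero

/-- Markov's inequality: a random permutation agrees with `τ` at one argument on average. -/
theorem card_many_agree_mul_le (τ : Perm α) [Nonempty α] :
    3 * Fintype.card α * (Finset.univ.filter fun σ : Perm α =>
      3 * Fintype.card α ≤ 5 * (Finset.univ.filter fun i => σ i = τ i).card).card ≤
        5 * (Fintype.card α)! := by
  rw [← sum_card_agree τ, Finset.mul_sum, mul_comm, ← smul_eq_mul]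
  refine (Finset.card_nsmul_le_sum _ _ _ fun σ hσ => (Finset.mem_filter.1 hσ).2).trans ?_
  exact Finset.sum_le_sum_of_subset (Finset.subset_univ _)

end Permutations

/-! ### The lower bound -/

section LowerBound

open Equiv Nat

theorem eqOrInverse_refl {n : ℕ} (f : Fin n → Fin n) : EqOrInverse n f f := .inl fun _ => rfl

theorem eqOrInverse_symm {n : ℕ} {f g : Fin n → Fin n} (h : EqOrInverse n f g) :
    EqOrInverse n g f := by
  rcases h with h | h
  · exact .inl fun i => (h i).symm
  · have hg : Function.Surjective g := fun i => ⟨f i, h i⟩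
    exact .inr ((show Function.LeftInverse g f from h).rightInverse_of_injective
      (Finite.injective_iff_surjective.2 hg))

/-- The concatenation of two strings of the same length. -/
def pairString {α : Type*} {n : ℕ} (f g : Fin n → α) : Fin (2 * n) → α := ofBlocks ![f, g]

theorem pairString_perm_inv_mem {n : ℕ} (π : Perm (Fin n)) :
    pairString (⇑π) (⇑π⁻¹) ∈ invStrings n :=
  .inr fun i => by simp [pairString]

/-- If the halves of `w` are equal, use the triangle inequality. If they are inverse to each other,
every disagreement of the second half with `π⁻¹` at `j` forces one of the first half with `π` at
`π⁻¹ j`. -/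
theorem le_hammingDist_of_mem_invStrings {n k : ℕ} (π : Perm (Fin n)) (g : Fin n → Fin n)
    (h1 : k ≤ hammingDist g π) (h2 : k ≤ hammingDist g ⇑π⁻¹) {w : Fin (2 * n) → Fin n}
    (hw : w ∈ invStrings n) : k ≤ hammingDist (pairString (⇑π) g) w := by
  rw [hammingDist_eq_sum_block, Fin.sum_univ_two, pairString, block_ofBlocks, block_ofBlocks]
  simp only [Matrix.cons_val_zero, Matrix.cons_val_one]
  rcases hw with h | h
  · rw [show block w 0 = block w 1 from funext h]
    refine h1.trans ((hammingDist_triangle_right _ _ (block w 1)).trans ?_)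
    rw [add_comm]
  · refine h2.trans ((hammingDist_triangle _ (block w 1) _).trans ?_)
    rw [add_comm]
    refine Nat.add_le_add_right ?_ _
    refine Finset.card_le_card_of_injOn ⇑π⁻¹ ?_ (π⁻¹).injective.injOn
    intro j hj
    simp only [Finset.coe_filter, Finset.mem_univ, true_and, Set.mem_ofPred_eq] at hj ⊢
    intro h'
    rw [Perm.coe_inv, Equiv.apply_symm_apply] at h'
    exact hj (by rw [Perm.coe_inv]; nth_rewrite 1 [h']; exact h _)

theorem far_of_le_hammingDist {n k : ℕ} (hk : 2 * n < 5 * k) (hn : 0 < n) (π : Perm (Fin n))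
    (g : Fin n → Fin n) (h1 : k ≤ hammingDist g π) (h2 : k ≤ hammingDist g ⇑π⁻¹) :
    ((1 / 5 : ℝ≥0) : ℝ≥0∞) < distToSet normHamming (pairString (⇑π) g) (invStrings n) := by
  have hlt : ((1 / 5 : ℝ≥0) : ℝ≥0∞) < (k : ℝ≥0∞) / ((2 * n : ℕ) : ℝ≥0∞) := by
    have h0 : ((2 * n : ℕ) : ℝ≥0) ≠ 0 := by positivity
    have e : (k : ℝ≥0∞) / ((2 * n : ℕ) : ℝ≥0∞) =
        (((k : ℝ≥0) / ((2 * n : ℕ) : ℝ≥0) : ℝ≥0) : ℝ≥0∞) := by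
      rw [ENNReal.coe_div h0]; simp
    rw [e, ENNReal.coe_lt_coe, div_lt_div_iff₀ (by norm_num) (by positivity)]
    exact_mod_cast (by omega : 1 * (2 * n) < k * 5)
  refine hlt.trans_le (le_iInf₂ fun w hw => ?_)
  rw [normHamming, Fintype.card_fin]
  gcongr
  exact le_hammingDist_of_mem_invStrings π g h1 h2 hw

/-! ### Acceptance of inverse pairs against acceptance of independent pairs -/

theorem SplitAlg.accepts_congr {α : Type*} {n : ℕ} (D : SplitAlg α 2 n)
    {f g f' g' : Fin n → α} (h0 : (D.tree 0).answers f = (D.tree 0).answers f')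
    (h1 : (D.tree 1).answers g = (D.tree 1).answers g') :
    D.Accepts (pairString f g) ↔ D.Accepts (pairString f' g') := by
  have h : (fun i => (D.tree i).answers (block (pairString f g) i)) =
      fun i => (D.tree i).answers (block (pairString f' g') i) := by
    funext i
    fin_cases i
    · simpa [pairString] using h0
    · simpa [pairString] using h1
  unfold Accepts
  rw [h]

theorem SplitAlg.queries_two {α : Type*} {n : ℕ} (D : SplitAlg α 2 n) :
    D.queries = D.height 0 + D.height 1 := Fin.sum_univ_two _

theorem splitAcceptProb_le_one {α : Type*} {k m : ℕ} (A : PMF (SplitAlg α k m))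
    (w : Fin (k * m) → α) : splitAcceptProb A w ≤ 1 :=
  (ENNReal.tsum_le_tsum fun _ => Set.indicator_le_self _ _ _).trans_eq A.tsum_coe

open Classical in
theorem sum_splitAcceptProb {α X : Type*} [Fintype X] {k m : ℕ} (A : PMF (SplitAlg α k m))
    (w : X → Fin (k * m) → α) :
    ∑ x, splitAcceptProb A (w x) =
      ∑' D, A D * ((Finset.univ.filter fun x => D.Accepts (w x)).card : ℝ≥0∞) := by
  unfold splitAcceptProb
  rw [← Summable.tsum_finsetSum fun _ _ => ENNReal.summable]
  refine tsum_congr fun D => ?_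
  simp only [Set.indicator_apply, Set.mem_ofPred_eq]
  rw [← Finset.sum_filter, Finset.sum_const, nsmul_eq_mul, mul_comm]

open Classical in
theorem SplitAlg.card_accepts_inv_le {n q : ℕ} (hn : 0 < n) (hq : 9 * q ^ 2 < n)
    (D : SplitAlg (Fin n) 2 n) (hD : D.queries ≤ q) :
    18 * n ! * (Finset.univ.filter fun π : Perm (Fin n) =>
        D.Accepts (pairString (⇑π) ⇑π⁻¹)).card ≤
      18 * (Finset.univ.filter fun p : Perm (Fin n) × Perm (Fin n) =>
        D.Accepts (pairString ⇑p.1 ⇑p.2)).card + n ! * n ! := by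
  -- The comparison of leaves is one-sided, so an upper bound on accepting inverse pairs comes from
  -- applying it to the rejected leaves.
  set B : Set ((Fin (D.height 0) → Fin n) × (Fin (D.height 1) → Fin n)) :=
    {l | ∃ f g, (D.tree 0).answers f = l.1 ∧ (D.tree 1).answers g = l.2 ∧
      ¬ D.Accepts (pairString f g)} with hB
  have hmem : ∀ f g, ((D.tree 0).answers f, (D.tree 1).answers g) ∈ B ↔
      ¬ D.Accepts (pairString f g) := by
    intro f g
    constructor
    · rintro ⟨f', g', h0, h1, h⟩
      rwa [D.accepts_congr h0.symm h1.symm]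
    · exact fun h => ⟨f, g, rfl, rfl, h⟩
  have h1 := card_independent_le (D.tree 0) (D.tree 1) B
  simp only [hmem, Fintype.card_fin] at h1
  have h2 := card_collide_mul_le (D.tree 0) (D.tree 1)
  rw [Fintype.card_fin] at h2
  rw [D.queries_two] at hD
  -- By the inequality of means, `36 q₁ q₂ ≤ 9 (q₁ + q₂)² ≤ 9 q² < n`.
  have h3 : 36 * (D.height 0 * D.height 1) ≤ n := by
    have h4 : (D.height 0 + D.height 1) ^ 2 ≤ q ^ 2 := Nat.pow_le_pow_left hD 2
    have h5 := four_mul_le_sq_add (D.height 0) (D.height 1)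
    nlinarith
  have h4 : 18 * (Finset.univ.filter fun p => Collide (D.tree 0) (D.tree 1) p).card ≤
      n ! * n ! := by
    refine Nat.le_of_mul_le_mul_left ?_ hn
    have := Nat.mul_le_mul_right (n ! * n !) h3
    linarith
  have h5 := Finset.card_filter_add_card_filter_not (s := (Finset.univ : Finset (Perm (Fin n))))
    fun π => D.Accepts (pairString (⇑π) ⇑π⁻¹)
  have h6 := Finset.card_filter_add_card_filter_not
    (s := (Finset.univ : Finset (Perm (Fin n) × Perm (Fin n))))
    fun p => D.Accepts (pairString ⇑p.1 ⇑p.2)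
  simp only [Finset.card_univ, Fintype.card_prod, Fintype.card_perm, Fintype.card_fin] at h5 h6
  have h7 := congrArg (n ! * ·) h5
  simp only [mul_add] at h7
  rw [mul_assoc]
  omega

open Classical in
theorem sum_splitAcceptProb_inv_le {n q : ℕ} (hn : 0 < n) (hq : 9 * q ^ 2 < n)
    (A : PMF (SplitAlg (Fin n) 2 n)) (hA : splitQueries A ≤ q) :
    (18 * n ! : ℕ) * ∑ π : Perm (Fin n), splitAcceptProb A (pairString (⇑π) ⇑π⁻¹) ≤
      18 * (∑ p : Perm (Fin n) × Perm (Fin n), splitAcceptProb A (pairString ⇑p.1 ⇑p.2)) +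
        (n ! * n ! : ℕ) := by
  rw [sum_splitAcceptProb, sum_splitAcceptProb, ← ENNReal.tsum_mul_left,
    ← ENNReal.tsum_mul_left]
  rw [← mul_one ((n ! * n ! : ℕ) : ℝ≥0∞)]
  rw [← A.tsum_coe, ← ENNReal.tsum_mul_left, ← ENNReal.tsum_add]
  refine ENNReal.tsum_le_tsum fun D => ?_
  by_cases h0 : A D = 0
  · simp [h0]
  · have hD : D.queries ≤ q := by
      have : (D.queries : ℕ∞) ≤ q := (le_iSup₂_of_le D h0 le_rfl).trans hA
      exact_mod_cast this
    have key := D.card_accepts_inv_le hn hq hD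
    calc _ = A D * ((18 * n ! * (Finset.univ.filter fun π : Perm (Fin n) =>
          D.Accepts (pairString (⇑π) ⇑π⁻¹)).card : ℕ) : ℝ≥0∞) := by push_cast; ring
      _ ≤ A D * ((18 * (Finset.univ.filter fun p : Perm (Fin n) × Perm (Fin n) =>
          D.Accepts (pairString ⇑p.1 ⇑p.2)).card + n ! * n ! : ℕ) : ℝ≥0∞) := by
          gcongr
      _ = _ := by push_cast; ring

/-- The pairs `(π, σ)` such that `σ` agrees with `π` or with `π⁻¹` on at least `3/5` of the
arguments. -/
def closePairs (n : ℕ) : Finset (Perm (Fin n) × Perm (Fin n)) :=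
  (Finset.univ.filter fun p => 3 * n ≤ 5 * (Finset.univ.filter fun i => p.2 i = p.1 i).card) ∪
  Finset.univ.filter fun p => 3 * n ≤ 5 * (Finset.univ.filter fun i => p.2 i = p.1⁻¹ i).card

/-- Each of the two kinds of closeness has probability at most `5 / (3n)`, and `10 / (3n) ≤ 1/3`
when `n ≥ 10`. -/
theorem card_closePairs_mul_le {n : ℕ} (hn : 10 ≤ n) :
    3 * (closePairs n).card ≤ n ! * n ! := by
  have : Nonempty (Fin n) := ⟨⟨0, by omega⟩⟩
  have h : ∀ r : Perm (Fin n) → Perm (Fin n), 3 * n * (Finset.univ.filter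
      fun p : Perm (Fin n) × Perm (Fin n) =>
        3 * n ≤ 5 * (Finset.univ.filter fun i => p.2 i = r p.1 i).card).card ≤
          5 * (n ! * n !) := by
    intro r
    rw [Finset.card_filter, Fintype.sum_prod_type, Finset.mul_sum]
    calc _ ≤ ∑ _π : Perm (Fin n), 5 * n ! := by
          refine Finset.sum_le_sum fun π _ => ?_
          rw [← Finset.card_filter]
          simpa using card_many_agree_mul_le (r π)
      _ = _ := by
          simp [Fintype.card_perm]
          ring
  have h1 := Nat.mul_le_mul_left (3 * n) (Finset.card_union_le
    (Finset.univ.filter fun p : Perm (Fin n) × Perm (Fin n) =>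
      3 * n ≤ 5 * (Finset.univ.filter fun i => p.2 i = p.1 i).card)
    (Finset.univ.filter fun p : Perm (Fin n) × Perm (Fin n) =>
      3 * n ≤ 5 * (Finset.univ.filter fun i => p.2 i = p.1⁻¹ i).card))
  have h2 := h id
  have h3 := h (·⁻¹)
  simp only [id] at h2 h3
  rw [mul_add] at h1
  change 3 * n * (closePairs n).card ≤ _ at h1
  have h4 : n * (3 * (closePairs n).card) ≤ 10 * (n ! * n !) := by linarith
  have h5 : 10 * (3 * (closePairs n).card) ≤ n * (3 * (closePairs n).card) :=
    Nat.mul_le_mul_right _ hn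
  omega

theorem far_of_notMem_closePairs {n : ℕ} (hn : 0 < n) {p : Perm (Fin n) × Perm (Fin n)}
    (hp : p ∉ closePairs n) :
    ((1 / 5 : ℝ≥0) : ℝ≥0∞) <
      distToSet normHamming (pairString ⇑p.1 ⇑p.2) (invStrings n) := by
  simp only [closePairs, Finset.mem_union, Finset.mem_filter, Finset.mem_univ, true_and,
    not_or, not_le] at hp
  have h : ∀ f g : Fin n → Fin n,
      (Finset.univ.filter fun i => f i = g i).card + hammingDist f g = n := by
    intro f g
    simpa [hammingDist] using Finset.card_filter_add_card_filter_not
      (s := (Finset.univ : Finset (Fin n))) fun i => f i = g i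
  have h1 := h p.2 p.1
  have h2 := h p.2 ⇑p.1⁻¹
  -- Fewer than `3n/5` agreements leave more than `2n/5` disagreements, which is more than `1/5` of
  -- the length `2n`.
  refine far_of_le_hammingDist
    (k := min (hammingDist ⇑p.2 ⇑p.1) (hammingDist ⇑p.2 ⇑p.1⁻¹)) ?_ hn _ _
    (min_le_left _ _) (min_le_right _ _)
  omega

theorem not_isSplitTest_of_queries_lt {n q : ℕ} (hn : 10 ≤ n) (hq : 9 * q ^ 2 < n)
    (A : PMF (SplitAlg (Fin n) 2 n)) (hA : splitQueries A ≤ q) :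
    ¬ IsSplitTest A (1 / 5) (invStrings n) := by
  rintro ⟨hyes, hno⟩
  have hn0 : 0 < n := by omega
  have h1 : (2 * n ! : ℕ) ≤
      3 * ∑ π : Perm (Fin n), splitAcceptProb A (pairString (⇑π) ⇑π⁻¹) := by
    rw [Finset.mul_sum]
    calc ((2 * n ! : ℕ) : ℝ≥0∞) = ∑ _π : Perm (Fin n), (2 : ℝ≥0∞) := by
          simp [Fintype.card_perm]
          ring
      _ ≤ _ := by
          refine Finset.sum_le_sum fun π _ => ?_
          have h := (hyes _ (pairString_perm_inv_mem π)).le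
          rwa [ENNReal.div_le_iff_le_mul (.inl (by simp)) (.inl (by simp)), mul_comm] at h
  have h2 : 3 * ∑ p : Perm (Fin n) × Perm (Fin n), splitAcceptProb A (pairString ⇑p.1 ⇑p.2) ≤
      (n ! * n ! + 2 * (closePairs n).card : ℕ) := by
    rw [Finset.mul_sum]
    -- Acceptance is at most `1/3` on far pairs and at most `1` on close ones; both bounds are
    -- multiplied by `3`.
    calc _ ≤ ∑ p : Perm (Fin n) × Perm (Fin n),
          (1 + if p ∈ closePairs n then 2 else 0 : ℝ≥0∞) := by
          refine Finset.sum_le_sum fun p _ => ?_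
          split_ifs with hp
          · calc 3 * splitAcceptProb A (pairString ⇑p.1 ⇑p.2) ≤ 3 * 1 := by
                  gcongr
                  exact splitAcceptProb_le_one _ _
              _ = 1 + 2 := by norm_num
          · have h := (hno _ (far_of_notMem_closePairs hn0 hp)).le
            rw [ENNReal.le_div_iff_mul_le (.inl (by simp)) (.inl (by simp))] at h
            rwa [add_zero, mul_comm]
      _ = _ := by
          rw [Finset.sum_add_distrib, ← Finset.sum_filter]
          simp [Fintype.card_perm]
          ring
  have h3 := sum_splitAcceptProb_inv_le hn0 hq A hA
  have h4 : ((36 * (n ! * n !) : ℕ) : ℝ≥0∞) ≤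
      (18 * (n ! * n ! + 2 * (closePairs n).card) + 3 * (n ! * n !) : ℕ) := by
    calc ((36 * (n ! * n !) : ℕ) : ℝ≥0∞) = (18 * n ! : ℕ) * (2 * n ! : ℕ) := by
          push_cast; ring
      _ ≤ (18 * n ! : ℕ) *
          (3 * ∑ π : Perm (Fin n), splitAcceptProb A (pairString (⇑π) ⇑π⁻¹)) := by gcongr
      _ = 3 * ((18 * n ! : ℕ) *
          ∑ π : Perm (Fin n), splitAcceptProb A (pairString (⇑π) ⇑π⁻¹)) := by ring
      _ ≤ 3 * (18 * (∑ p : Perm (Fin n) × Perm (Fin n),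
          splitAcceptProb A (pairString ⇑p.1 ⇑p.2)) + (n ! * n ! : ℕ)) := by gcongr
      _ = 18 * (3 * ∑ p : Perm (Fin n) × Perm (Fin n),
          splitAcceptProb A (pairString ⇑p.1 ⇑p.2)) + 3 * (n ! * n ! : ℕ) := by ring
      _ ≤ 18 * (n ! * n ! + 2 * (closePairs n).card : ℕ) + 3 * (n ! * n ! : ℕ) := by gcongr
      _ = _ := by push_cast; ring
  have h5 : 36 * (n ! * n !) ≤
      18 * (n ! * n ! + 2 * (closePairs n).card) + 3 * (n ! * n !) := by exact_mod_cast h4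
  have h6 := card_closePairs_mul_le hn
  have h7 : 0 < n ! * n ! := by positivity
  omega

/-- This covers the small `n` that the counting argument misses. With no queries the verdict cannot
separate `(id, id)` from the identity paired with a cyclic shift, which has no fixed point. -/
theorem not_isSplitTest_of_queries_eq_zero {n : ℕ} (hn : 2 ≤ n)
    (A : PMF (SplitAlg (Fin n) 2 n)) (hA : splitQueries A ≤ 0) :
    ¬ IsSplitTest A (1 / 5) (invStrings n) := by
  rintro ⟨hyes, hno⟩
  have hrot : ∀ i, finRotate n i ≠ i := by
    obtain ⟨m, rfl⟩ : ∃ m, n = m + 2 := ⟨n - 2, by omega⟩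
    intro i
    rw [finRotate_apply]
    simp
  have hd : n ≤ hammingDist ⇑(finRotate n) ⇑(1 : Perm (Fin n)) := by
    rw [hammingDist, Finset.filter_true_of_mem fun i _ => by exact hrot i]
    simp
  have hfar := hno _ (far_of_le_hammingDist (k := n) (by omega) (by omega) 1
    (finRotate n) hd (by simpa using hd))
  have hmem := hyes _ (pairString_perm_inv_mem (1 : Perm (Fin n)))
  have heq : splitAcceptProb A (pairString ⇑(1 : Perm (Fin n)) ⇑(1 : Perm (Fin n))⁻¹) =
      splitAcceptProb A (pairString ⇑(1 : Perm (Fin n)) ⇑(finRotate n)) := by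
    classical
    refine tsum_congr fun D => ?_
    by_cases h0 : A D = 0
    · simp only [Set.indicator_apply, h0, ite_self]
    · have hD : D.queries = 0 := by
        have : (D.queries : ℕ∞) ≤ 0 := (le_iSup₂_of_le D h0 le_rfl).trans hA
        exact_mod_cast le_antisymm this _root_.zero_le
      rw [D.queries_two] at hD
      have : IsEmpty (Fin (D.height 1)) := by
        rw [show D.height 1 = 0 by omega]
        infer_instance
      have h := D.accepts_congr (f := ⇑(1 : Perm (Fin n))) (g := ⇑(1 : Perm (Fin n))⁻¹)
        (g' := ⇑(finRotate n)) rfl (Subsingleton.elim _ _)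
      simp only [Set.indicator_apply, Set.mem_ofPred_eq, h]
  have h13 : (1 / 3 : ℝ≥0∞) ≤ 2 / 3 := by
    gcongr
    norm_num
  exact absurd (hmem.trans (heq.trans_lt hfar)) (not_lt.2 h13)

theorem le_splitQueries_of_isSplitTest {n : ℕ} (hn : 2 ≤ n) (A : PMF (SplitAlg (Fin n) 2 n))
    (h : IsSplitTest A (1 / 5) (invStrings n)) (q : ℕ) (hA : splitQueries A ≤ q) :
    (1 / 3 : ℝ) * Real.sqrt n ≤ q := by
  by_contra! hlt
  have hq : 9 * q ^ 2 < n := by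
    have h1 : (3 * q : ℝ) < Real.sqrt n := by linarith
    have h2 := (Real.lt_sqrt (by positivity)).1 h1
    have h3 : (9 * q ^ 2 : ℝ) < n := by linarith
    exact_mod_cast h3
  -- A positive `q` with `9 q² < n` forces `n ≥ 10`, as the counting argument requires.
  rcases Nat.eq_zero_or_pos q with rfl | hq0
  · exact not_isSplitTest_of_queries_eq_zero hn A (by simpa using hA) h
  · exact not_isSplitTest_of_queries_lt (by nlinarith) hq A hA h

end LowerBound

end
end HugeObject

theorem mainTheorem1 :
    -- every locally-bounded `1/5`-test for `Inv` makes at least `√n / 3` queries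
    (∀ n : ℕ, 2 ≤ n → ∀ (s : ℕ) (A : PMF (HugeObject.LocallyBoundedAlg (Fin n) n s)),
      HugeObject.IsLBTest A (1 / 5) (HugeObject.Inv n) →
      ∀ q : ℕ, HugeObject.lbQueries A ≤ q → (1 / 3 : ℝ) * Real.sqrt n ≤ q) ∧
    -- every 2-split adaptive `1/5`-test for `inv` makes at least `√n / 3` queries
    (∀ n : ℕ, 2 ≤ n → ∀ A : PMF (HugeObject.SplitAlg (Fin n) 2 n),
      HugeObject.IsSplitTest A (1 / 5) (HugeObject.invStrings n) →
      ∀ q : ℕ, HugeObject.splitQueries A ≤ q → (1 / 3 : ℝ) * Real.sqrt n ≤ q) ∧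
    -- construction of a 2-split adaptive string test from a locally-bounded one
    (∀ (α : Type*) [Fintype α] [DecidableEq α] (n s : ℕ),
      ∃ conv : PMF (HugeObject.LocallyBoundedAlg α n s) → PMF (HugeObject.SplitAlg α 2 n),
        ∀ A, HugeObject.splitQueries (conv A) = HugeObject.lbQueries A ∧
          ∀ R : (Fin n → α) → (Fin n → α) → Prop, (∀ u, R u u) → (∀ u v, R u v → R v u) →
          ∀ ε : NNReal, 0 < ε →
            (HugeObject.IsLBTest A ε (HugeObject.pairDistributions R) →
              HugeObject.IsSplitTest (conv A) ε (HugeObject.pairStrings R)) ∧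
            (HugeObject.IsOneSidedLBTest A ε (HugeObject.pairDistributions R) →
              HugeObject.IsOneSidedSplitTest (conv A) ε (HugeObject.pairStrings R))) := by
  refine ⟨fun n hn s A hA q hq => ?_, fun n hn A hA q hq => ?_, fun α _ _ n s => ?_⟩
  · refine HugeObject.le_splitQueries_of_isSplitTest hn (HugeObject.randomSplit 2 A) ?_ q ?_
    · exact HugeObject.isSplitTest_randomSplit HugeObject.eqOrInverse_refl
        (fun _ _ => HugeObject.eqOrInverse_symm) hA
    · rwa [HugeObject.splitQueries_randomSplit]
  · exact HugeObject.le_splitQueries_of_isSplitTest hn A hA q hq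
  · exact ⟨HugeObject.randomSplit 2, fun A => ⟨HugeObject.splitQueries_randomSplit A,
      fun R hr hs ε _ => ⟨HugeObject.isSplitTest_randomSplit hr hs,
        HugeObject.isOneSidedSplitTest_randomSplit hr hs⟩⟩⟩
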